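/- Let $\theta=[0;1,1,a_3,a_4,\dots]$ be an irrational number with partial quotients $a_\nu$ ($a_0=0$, $a_1=a_2=1$), and let $P_\nu/Q_\nu=[0;a_1,\dots,a_\nu]$ be its convergents. Suppose that $$\lim_{\nu\to\infty}\frac{Q_{\nu-1}}{a_{\nu+1}}=0 .$$ Then there is a continuous $1$-periodic function $g_\theta:\mathbb{R}\to\mathbb{R}$ of bounded variation, with variation $2$ on $[0,1]$ and $\int_0^1 g_\theta(x)\,dx=0$, such that $$\liminf_{\nu\to\infty}\sum_{k=0}^{Q_\nu-1}g_\theta(k\theta)>0,\qquad\text{and in fact}\qquad \lim_{\nu\to\infty}\sum_{k=0}^{Q_\nu-1}g_\theta(k\theta)=\frac16 .$$ Moreover $g_\theta$ can be taken to be of the following singular type, adapted to the orbit of $\theta$: $g_\theta$ is nonincreasing on $[0,\theta]$ and nondecreasing on $[\theta,1]$, $g_\theta(0)-g_\theta(\theta)=1$, and for every $\nu\ge 2$, every two neighbouring points $a<b$ of the set $\{0,\{\theta\},\{2\theta\},\dots,\{(Q_\nu-1)\theta\}\}\cup\{1\}$, and every $k$ with $Q_\nu\le k<Q_{\nu+1}$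 and $a<\{k\theta\}<b$, $$g_\theta(\{k\theta\})=\begin{cases}\tfrac13 g_\theta(a)+\tfrac23 g_\theta(b), & b\le\theta,\\[2pt] \tfrac12 g_\theta(a)+\tfrac12 g_\theta(b), & a\ge\theta.\end{cases}$$ -/

import Mathlib

open Filter Topology Set

/-- The partial quotients `a₀, a₁, a₂, …` of the regular continued fraction
`θ = [a₀; a₁, a₂, …]` (with value `0` after the expansion has ended, which for an irrational
number never happens). -/
noncomputable def partialQuotient (θ : ℝ) : ℕ → ℝ
  | 0 => (GenContFract.of θ).h
  | n + 1 => ((GenContFract.of θ).partDens.get? n).getD 0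

/-- The denominator `Q_ν` of the convergent `P_ν / Q_ν = [a₀; a₁, …, a_ν]` of `θ`, as a natural
number; nothing is lost by the floor, see `convDenom_cast`. -/
noncomputable def convDenom (θ : ℝ) (ν : ℕ) : ℕ := ⌊(GenContFract.of θ).dens ν⌋₊

theorem exists_nat_dens (θ : ℝ) (n : ℕ) :
    (∃ m : ℕ, (GenContFract.of θ).dens n = m) ∧
      ∃ m : ℕ, (GenContFract.of θ).dens (n + 1) = m := by
  have hb : ∀ (i : ℕ) (gp : GenContFract.Pair ℝ), (GenContFract.of θ).s.get? i = some gp →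
      gp.a = 1 ∧ ∃ z : ℕ, gp.b = z := by
    intro i gp h
    refine ⟨GenContFract.of_partNum_eq_one (GenContFract.partNum_eq_s_a h), ?_⟩
    have hd := GenContFract.partDen_eq_s_b h
    obtain ⟨z, hz⟩ := GenContFract.exists_int_eq_of_partDen hd
    have h1 := GenContFract.of_one_le_get?_partDen hd
    rw [hz] at h1
    have h2 : (0 : ℤ) ≤ z := by
      have : (1 : ℤ) ≤ z := by exact_mod_cast h1
      linarith
    lift z to ℕ using h2
    exact ⟨z, by simpa using hz⟩
  induction n with
  | zero =>
    refine ⟨⟨1, by simp⟩, ?_⟩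
    cases h : (GenContFract.of θ).s.get? 0 with
    | none =>
      refine ⟨1, ?_⟩
      rw [GenContFract.dens_stable_of_terminated (Nat.zero_le 1) h]
      simp
    | some gp =>
      obtain ⟨-, z, hz⟩ := hb 0 gp h
      exact ⟨z, by rw [GenContFract.first_den_eq h, hz]⟩
  | succ n ih =>
    refine ⟨ih.2, ?_⟩
    obtain ⟨⟨p, hp⟩, ⟨q, hq⟩⟩ := ih
    cases h : (GenContFract.of θ).s.get? (n + 1) with
    | none =>
      refine ⟨q, ?_⟩
      rw [GenContFract.dens_stable_of_terminated (Nat.le_succ (n + 1)) h, hq]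
    | some gp =>
      obtain ⟨h1, z, hz⟩ := hb (n + 1) gp h
      refine ⟨z * q + p, ?_⟩
      rw [GenContFract.dens_recurrence h hp hq, h1, hz]
      push_cast
      ring

theorem convDenom_cast (θ : ℝ) (ν : ℕ) :
    (convDenom θ ν : ℝ) = (GenContFract.of θ).dens ν := by
  obtain ⟨m, hm⟩ := (exists_nat_dens θ ν).1
  rw [convDenom, hm, Nat.floor_natCast]

/-- The points `0, {θ}, {2θ}, …, {(N-1)θ}` of the Kronecker sequence, completed by the
point `1`. -/
def orbitPoints (θ : ℝ) (N : ℕ) : Set ℝ :=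
  {x | ∃ k : ℕ, k < N ∧ x = Int.fract ((k : ℝ) * θ)} ∪ {1}

/-- `[a, b]` is one of the segments into which the points of `orbitPoints θ N` divide `[0, 1]`:
`a < b` are neighbouring points of that set. -/
def IsOrbitSegment (θ : ℝ) (N : ℕ) (a b : ℝ) : Prop :=
  a ∈ orbitPoints θ N ∧ b ∈ orbitPoints θ N ∧ a < b ∧ ∀ x ∈ orbitPoints θ N, ¬ (a < x ∧ x < b)

/-- The singular-type construction adapted to the orbit of `θ`, up to an additive constant:
`g` falls by `1` on `[0, θ]`, is nonincreasing there and nondecreasing on `[θ, 1]`, and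
each orbit point `{kθ}`, `Q_ν ≤ k < Q_{ν+1}`, `ν ≥ 2`, which falls into a segment `[a, b]` of
level `ν` gets the value `g a / 3 + 2 g b / 3` to the left of `θ`, `g a / 2 + g b / 2` to the
right of `θ`. (By monotonicity `g` is constant on a segment with `g a = g b`.) -/
structure IsOrbitSingular (θ : ℝ) (g : ℝ → ℝ) : Prop where
  drop : g 0 - g θ = 1
  antitoneOn : AntitoneOn g (Icc 0 θ)
  monotoneOn : MonotoneOn g (Icc θ 1)
  left : ∀ ν : ℕ, 2 ≤ ν → ∀ a b : ℝ, IsOrbitSegment θ (convDenom θ ν) a b → b ≤ θ →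
    ∀ k : ℕ, convDenom θ ν ≤ k → k < convDenom θ (ν + 1) →
      Int.fract ((k : ℝ) * θ) ∈ Ioo a b →
        g (Int.fract ((k : ℝ) * θ)) = 1 / 3 * g a + 2 / 3 * g b
  right : ∀ ν : ℕ, 2 ≤ ν → ∀ a b : ℝ, IsOrbitSegment θ (convDenom θ ν) a b → θ ≤ a →
    ∀ k : ℕ, convDenom θ ν ≤ k → k < convDenom θ (ν + 1) →
      Int.fract ((k : ℝ) * θ) ∈ Ioo a b →
        g (Int.fract ((k : ℝ) * θ)) = 1 / 2 * g a + 1 / 2 * g b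

/-! Fix a level `N = Q_{n+1}`, let `0 = p_0 < … < p_N = 1` be the orbit points with 1 added, and let
`d_n = |Q_n θ - P_n|`. On a segment `[p_i, p_{i+1}]` the rule gives every orbit point that is new at
the next level the same value `W_i`, a weighted mean of the two end values. The gaps of the next
level have length at most `η = d_{n+1} + d_{n+2}`, so monotonicity makes `g` equal to `W_i` on the
whole segment except within `η` of its ends (`IsOrbitSegment.eq_of_mem_plateau`).

Two computations then meet. Telescoping to the left and to the right of `θ`, where `g` falls by 1
and rises by 1, shows that `∑ W_i` is the orbit sum plus `2/3 · (-1) + 1/2 · 1 = -1/6`. On the other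
hand, `∫ g = 0` and the plateaus make the length-weighted sum of the `W_i` at most `4η` in absolute
value. The lengths are nearly `1/N`, with total deviation governed by `1 - N d_n = Q_n d_{n+1}`.
Hence `∑ W_i` is bounded by a multiple of `Q_n / a_{n+2}`, which tends to 0
(`IsOrbitSingular.abs_sum_sub_le`).

For existence, the rule prescribes consistent monotone values on the dense orbit. Every gap is split
within two levels, and each split shrinks the increments by a factor of at most 2/3, so the monotone
extension is continuous (`exists_continuousOn_staircase`). Two such staircases are glued at `θ` and
the mean is subtracted (`exists_isOrbitSingular`). -/

/-! ### Convergents and their approximation errors. -/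

/-- For irrational `θ` the continued fraction never ends, and its partial quotients after the
zeroth are positive integers. -/
theorem exists_nat_partialQuotient {θ : ℝ} (hθ : Irrational θ) (n : ℕ) :
    ∃ z : ℕ, 1 ≤ z ∧ (GenContFract.of θ).s.get? n = some ⟨1, (z : ℝ)⟩ ∧
      partialQuotient θ (n + 1) = z := by
  cases h : (GenContFract.of θ).s.get? n with
  | none =>
    exfalso
    obtain ⟨q, hq⟩ := (GenContFract.terminates_iff_rat θ).1 ⟨n, h⟩
    exact hθ ⟨q, hq.symm⟩
  | some gp =>
    have ha := GenContFract.of_partNum_eq_one (GenContFract.partNum_eq_s_a h)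
    have hd := GenContFract.partDen_eq_s_b h
    obtain ⟨z, hz⟩ := GenContFract.exists_int_eq_of_partDen hd
    have h1 := GenContFract.of_one_le_get?_partDen hd
    have hz1 : (1 : ℤ) ≤ z := by
      rw [hz] at h1
      exact_mod_cast h1
    lift z to ℕ using by linarith
    refine ⟨z, by exact_mod_cast hz1, ?_, ?_⟩
    · cases gp
      simp_all
    · simp [partialQuotient, hd, hz]

theorem convDenom_zero (θ : ℝ) : convDenom θ 0 = 1 := by
  simp [convDenom]

theorem convDenom_one {θ : ℝ} (hθ : Irrational θ) :
    (convDenom θ 1 : ℝ) = partialQuotient θ 1 := by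
  obtain ⟨z, -, hs, hz⟩ := exists_nat_partialQuotient hθ 0
  rw [convDenom_cast, GenContFract.first_den_eq hs, hz]

theorem convDenom_add_two {θ : ℝ} (hθ : Irrational θ) (n : ℕ) :
    (convDenom θ (n + 2) : ℝ) =
      partialQuotient θ (n + 2) * convDenom θ (n + 1) + convDenom θ n := by
  obtain ⟨z, -, hs, hz⟩ := exists_nat_partialQuotient hθ (n + 1)
  simp only [convDenom_cast]
  rw [GenContFract.dens_recurrence hs rfl rfl, hz]
  ring

theorem nums_add_two {θ : ℝ} (hθ : Irrational θ) (n : ℕ) :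
    (GenContFract.of θ).nums (n + 2) =
      partialQuotient θ (n + 2) * (GenContFract.of θ).nums (n + 1) +
        (GenContFract.of θ).nums n := by
  obtain ⟨z, -, hs, hz⟩ := exists_nat_partialQuotient hθ (n + 1)
  rw [GenContFract.nums_recurrence hs rfl rfl, hz]
  ring

theorem one_le_partialQuotient {θ : ℝ} (hθ : Irrational θ) (n : ℕ) :
    1 ≤ partialQuotient θ (n + 1) := by
  obtain ⟨z, h1, -, hz⟩ := exists_nat_partialQuotient hθ n
  rw [hz]
  exact_mod_cast h1

theorem exists_int_nums {θ : ℝ} (hθ : Irrational θ) (n : ℕ) :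
    (∃ p : ℤ, (GenContFract.of θ).nums n = p) ∧
      ∃ p : ℤ, (GenContFract.of θ).nums (n + 1) = p := by
  induction n with
  | zero =>
    obtain ⟨z, -, hs, -⟩ := exists_nat_partialQuotient hθ 0
    refine ⟨⟨⌊θ⌋, by simp⟩, ⟨z * ⌊θ⌋ + 1, ?_⟩⟩
    rw [GenContFract.first_num_eq hs]
    simp
  | succ n ih =>
    refine ⟨ih.2, ?_⟩
    obtain ⟨⟨p, hp⟩, ⟨q, hq⟩⟩ := ih
    obtain ⟨z, -, -, hz⟩ := exists_nat_partialQuotient hθ (n + 1)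
    refine ⟨z * q + p, ?_⟩
    rw [nums_add_two hθ, hp, hq, hz]
    push_cast
    ring

theorem convDenom_det {θ : ℝ} (hθ : Irrational θ) (n : ℕ) :
    (GenContFract.of θ).nums n * convDenom θ (n + 1) -
      convDenom θ n * (GenContFract.of θ).nums (n + 1) = (-1) ^ (n + 1) := by
  simp only [convDenom_cast]
  rw [GenContFract.determinant, Finset.prod_congr rfl (g := fun _ => (-1 : ℝ))]
  · simp
  · intro i _
    obtain ⟨z, -, hs, -⟩ := exists_nat_partialQuotient hθ i
    rw [GenContFract.partNum_eq_s_a hs]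
    simp

theorem convDenom_le_succ (θ : ℝ) (n : ℕ) : convDenom θ n ≤ convDenom θ (n + 1) := by
  have h := GenContFract.of_den_mono (v := θ) (n := n)
  rw [← convDenom_cast, ← convDenom_cast] at h
  exact_mod_cast h

theorem convDenom_mono (θ : ℝ) : Monotone (convDenom θ) :=
  monotone_nat_of_le_succ (convDenom_le_succ θ)

theorem convDenom_pos (θ : ℝ) (n : ℕ) : 0 < convDenom θ n := by
  have := convDenom_mono θ (Nat.zero_le n)
  rw [convDenom_zero] at this
  omega

/-- The signed, normalized error `(-1) ^ ν (Q_ν θ - P_ν)` of the convergent `P_ν / Q_ν`. -/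
noncomputable def convError (θ : ℝ) (ν : ℕ) : ℝ :=
  (-1) ^ ν * (convDenom θ ν * θ - (GenContFract.of θ).nums ν)

theorem convError_eq (θ : ℝ) (n : ℕ) :
    (convDenom θ n : ℝ) * θ - (GenContFract.of θ).nums n = (-1) ^ n * convError θ n := by
  rw [convError, ← mul_assoc, ← mul_pow]
  simp

theorem convError_rec {θ : ℝ} (hθ : Irrational θ) (n : ℕ) :
    convError θ n = partialQuotient θ (n + 2) * convError θ (n + 1) + convError θ (n + 2) := by
  simp only [convError, convDenom_add_two hθ, nums_add_two hθ, pow_succ]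
  ring

/-- The determinant identity with `θ` inserted. It later measures how far `1/Q_{n+1}` is from the
shortest gap `d_n`. -/
theorem convError_det {θ : ℝ} (hθ : Irrational θ) (n : ℕ) :
    convError θ n * convDenom θ (n + 1) + convError θ (n + 1) * convDenom θ n = 1 := by
  have h := convDenom_det hθ n
  have h2 : ((-1 : ℝ) ^ n) * (-1) ^ n = 1 := by rw [← mul_pow]; simp
  simp only [convError, pow_succ] at *
  linear_combination (-(-1 : ℝ) ^ n) * h + h2

theorem convError_pos {θ : ℝ} (hθ : Irrational θ) (n : ℕ) : 0 < convError θ n := by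
  have hQ : (0 : ℝ) < convDenom θ n := by exact_mod_cast convDenom_pos θ n
  have hne : ∀ m, convError θ m ≠ 0 := by
    intro m hm
    obtain ⟨p, hp⟩ := (exists_int_nums hθ m).1
    have hQ : (convDenom θ m : ℝ) ≠ 0 := by exact_mod_cast (convDenom_pos θ m).ne'
    have := convError_eq θ m
    rw [hm, hp, mul_zero, sub_eq_zero] at this
    refine hθ ⟨(p : ℚ) / convDenom θ m, ?_⟩
    push_cast
    rw [← this]
    field_simp
  refine lt_of_le_of_ne ?_ (hne n).symm
  cases h : GenContFract.IntFractPair.stream θ n with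
  | none =>
    exfalso
    obtain ⟨z, -, hs, -⟩ := exists_nat_partialQuotient hθ n
    have h2 := GenContFract.of_terminatedAt_n_iff_succ_nth_intFractPair_stream_eq_none (v := θ)
      (n := n)
    have h3 : GenContFract.IntFractPair.stream θ (n + 1) = none :=
      GenContFract.IntFractPair.stream_isSeq θ h
    have := h2.2 h3
    rw [GenContFract.TerminatedAt, Stream'.Seq.TerminatedAt, hs] at this
    cases this
  | some ifp =>
    have h1 := GenContFract.sub_convs_eq h
    simp only at h1
    have h4 : 0 ≤ ifp.fr := GenContFract.IntFractPair.nth_stream_fr_nonneg h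
    have h5 : (0 : ℝ) ≤ ((GenContFract.of θ).contsAux n).b := GenContFract.zero_le_of_contsAux_b
    have h6 : (0 : ℝ) ≤ ((GenContFract.of θ).contsAux (n + 1)).b :=
      GenContFract.zero_le_of_contsAux_b
    have h7 : (GenContFract.of θ).nums n = (GenContFract.of θ).convs n * convDenom θ n := by
      rw [GenContFract.conv_eq_num_div_den, ← convDenom_cast]
      field_simp
    have h8 : convError θ n =
        (convDenom θ n : ℝ) * ((-1) ^ n * (θ - (GenContFract.of θ).convs n)) := by
      rw [convError, h7]
      ring
    rw [h8, h1]
    refine mul_nonneg hQ.le ?_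
    split_ifs
    · simp
    · rw [← mul_div_assoc, ← mul_pow]
      simp only [mul_neg, mul_one, neg_neg, one_pow]
      positivity

theorem convError_add_le {θ : ℝ} (hθ : Irrational θ) (n : ℕ) :
    convError θ (n + 1) + convError θ (n + 2) ≤ convError θ n := by
  have h := convError_rec hθ n
  have h1 := one_le_partialQuotient hθ (n + 1)
  have h2 := convError_pos hθ (n + 1)
  nlinarith

theorem convError_succ_lt {θ : ℝ} (hθ : Irrational θ) (n : ℕ) :
    convError θ (n + 1) < convError θ n := by
  linarith [convError_add_le hθ n, convError_pos hθ (n + 2)]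

theorem convError_mul_le_one {θ : ℝ} (hθ : Irrational θ) (n : ℕ) :
    convError θ n * convDenom θ (n + 1) ≤ 1 := by
  have h := convError_det hθ n
  have h2 : 0 ≤ convError θ (n + 1) * convDenom θ n :=
    mul_nonneg (convError_pos hθ _).le (Nat.cast_nonneg _)
  linarith

/-- The convergents give the best approximations: `|q θ - p| ≥ |Q_n θ - P_n|` for
`0 < q < Q_{n+1}`. -/
theorem convError_le_abs {θ : ℝ} (hθ : Irrational θ) (n : ℕ) {q : ℤ} (p : ℤ) (hq0 : 0 < q)
    (hq : q < convDenom θ (n + 1)) : convError θ n ≤ |(q : ℝ) * θ - p| := by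
  obtain ⟨⟨P, hP⟩, ⟨P', hP'⟩⟩ := exists_int_nums hθ n
  have hdet := convDenom_det hθ n
  have e1 := convError_eq θ n
  have e2 := convError_eq θ (n + 1)
  have p1 := convError_pos hθ n
  have p2 := convError_pos hθ (n + 1)
  have hQ := convDenom_pos θ n
  have hQ' := convDenom_pos θ (n + 1)
  rw [hP, hP'] at hdet
  rw [hP] at e1
  rw [hP'] at e2
  generalize convDenom θ n = Q at *
  generalize convDenom θ (n + 1) = Q' at *
  generalize convError θ n = d at *
  generalize convError θ (n + 1) = d' at *
  have hdet' : P * (Q' : ℤ) - Q * P' = (-1) ^ (n + 1) := by exact_mod_cast hdet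
  set s : ℤ := (-1) ^ (n + 1) with hs
  have hss : s * s = 1 := by rw [hs, ← mul_pow]; simp
  -- The coordinates of `(q, p)` in the unimodular basis `(Q, P)`, `(Q', P')`.
  obtain ⟨x, hx⟩ : ∃ x, x = s * (p * Q' - q * P') := ⟨_, rfl⟩
  obtain ⟨y, hy⟩ : ∃ y, y = s * (P * q - Q * p) := ⟨_, rfl⟩
  have hqe : q = x * Q + y * Q' := by
    rw [hx, hy]
    linear_combination (-q * s) * hdet' - q * hss
  have hpe : p = x * P + y * P' := by
    rw [hx, hy]
    linear_combination (-p * s) * hdet' - p * hss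
  have key : (q : ℝ) * θ - p = (-1) ^ n * (x * d - y * d') := by
    have hq' : (q : ℝ) = x * Q + y * Q' := by exact_mod_cast hqe
    have hp' : (p : ℝ) = x * P + y * P' := by exact_mod_cast hpe
    rw [hq', hp']
    rw [pow_succ] at e2
    linear_combination (x : ℝ) * e1 + (y : ℝ) * e2
  rw [key, abs_mul, abs_pow]
  simp only [abs_neg, abs_one, one_pow, one_mul]
  have hQz : (0 : ℤ) < Q := by exact_mod_cast hQ
  have hQz' : (0 : ℤ) < Q' := by exact_mod_cast hQ'
  -- Since `0 < q < Q'`, `x` is nonzero and `y` is zero or of opposite sign. The two terms of `x * d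
  -- - y * d'` therefore do not cancel, and the first alone has size at least `d`.
  rcases le_or_gt x 0 with hx0 | hx0
  · have hy1 : 1 ≤ y := by
      by_contra hcon
      nlinarith
    have hx1 : x ≤ -1 := by
      by_contra hcon
      have : x = 0 := by omega
      subst this
      nlinarith
    have hx1' : (x : ℝ) ≤ -1 := by exact_mod_cast hx1
    have hy1' : (1 : ℝ) ≤ y := by exact_mod_cast hy1
    rw [abs_of_neg (by nlinarith)]
    nlinarith
  · have hy0 : y ≤ 0 := by
      by_contra hcon
      nlinarith
    have hx1' : (1 : ℝ) ≤ x := by exact_mod_cast hx0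
    have hy1' : (y : ℝ) ≤ 0 := by exact_mod_cast hy0
    rw [abs_of_pos (by nlinarith)]
    nlinarith

/-! ### Gaps between orbit points. -/

theorem finite_orbitPoints (θ : ℝ) (N : ℕ) : (orbitPoints θ N).Finite := by
  refine Set.Finite.union (((Finset.range N).image
    (fun k : ℕ => Int.fract ((k : ℝ) * θ))).finite_toSet.subset ?_) (Set.finite_singleton 1)
  rintro x ⟨k, hk, rfl⟩
  simpa using ⟨k, hk, rfl⟩

theorem orbitPoints_mono (θ : ℝ) {M N : ℕ} (h : M ≤ N) : orbitPoints θ M ⊆ orbitPoints θ N := by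
  rintro x (⟨k, hk, rfl⟩ | hx)
  · exact Or.inl ⟨k, hk.trans_le h, rfl⟩
  · exact Or.inr hx

theorem orbitPoints_subset_Icc (θ : ℝ) (N : ℕ) : orbitPoints θ N ⊆ Icc 0 1 := by
  rintro x (⟨k, hk, rfl⟩ | hx)
  · exact ⟨Int.fract_nonneg _, (Int.fract_lt_one _).le⟩
  · rw [mem_singleton_iff.1 hx]
    simp

theorem one_mem_orbitPoints (θ : ℝ) (N : ℕ) : (1 : ℝ) ∈ orbitPoints θ N := Or.inr rfl

theorem zero_mem_orbitPoints (θ : ℝ) {N : ℕ} (h : 0 < N) : (0 : ℝ) ∈ orbitPoints θ N :=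
  Or.inl ⟨0, h, by simp⟩

theorem exists_eq_of_mem_orbitPoints {θ : ℝ} {N : ℕ} (hN : 0 < N) {x : ℝ}
    (h : x ∈ orbitPoints θ N) : ∃ k : ℕ, k < N ∧ ∃ m : ℤ, x = k * θ - m := by
  rcases h with ⟨k, hk, rfl⟩ | hx
  · exact ⟨k, hk, ⌊(k : ℝ) * θ⌋, rfl⟩
  · exact ⟨0, hN, -1, by rw [mem_singleton_iff.1 hx]; simp⟩

theorem mem_orbitPoints_of_eq {θ : ℝ} {N : ℕ} {k : ℕ} (hk : k < N) {m : ℤ} {x : ℝ}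
    (h : x = k * θ - m) (h0 : 0 ≤ x) (h1 : x < 1) : x ∈ orbitPoints θ N := by
  refine Or.inl ⟨k, hk, ?_⟩
  rw [← Int.fract_sub_intCast (k * θ) m, ← h, Int.fract_eq_self.2 ⟨h0, h1⟩]

theorem convError_le_sub {θ : ℝ} (hθ : Irrational θ) (n : ℕ) {a b : ℝ}
    (ha : a ∈ orbitPoints θ (convDenom θ (n + 1))) (hb : b ∈ orbitPoints θ (convDenom θ (n + 1)))
    (hab : a < b) : convError θ n ≤ b - a := by
  obtain ⟨k, hk, m, rfl⟩ := exists_eq_of_mem_orbitPoints (convDenom_pos θ _) ha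
  obtain ⟨l, hl, m', rfl⟩ := exists_eq_of_mem_orbitPoints (convDenom_pos θ _) hb
  rcases lt_trichotomy k l with h | h | h
  · have := convError_le_abs hθ n (q := (l : ℤ) - k) (m' - m) (by omega) (by omega)
    push_cast at this
    rwa [show ((l : ℝ) - k) * θ - (m' - m) = l * θ - m' - (k * θ - m) by ring,
      abs_of_pos (by linarith)] at this
  -- Equal indices occur only for the pair 0, 1, because 1 is represented with index 0; the distance
  -- is then a positive integer.
  · subst h
    have h1 : (0 : ℝ) < m - m' := by linarith
    have h2 : (1 : ℝ) ≤ m - m' := by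
      have : (0 : ℤ) < m - m' := by exact_mod_cast h1
      exact_mod_cast this
    have h3 := convError_mul_le_one hθ n
    have h4 := convError_pos hθ n
    have h5 : (1 : ℝ) ≤ convDenom θ (n + 1) := by exact_mod_cast convDenom_pos θ (n + 1)
    nlinarith
  · have := convError_le_abs hθ n (q := (k : ℤ) - l) (m - m') (by omega) (by omega)
    push_cast at this
    rwa [show ((k : ℝ) - l) * θ - (m - m') = -(l * θ - m' - (k * θ - m)) by ring, abs_neg,
      abs_of_pos (by linarith)] at this

/-- From each orbit point, moving by at most `|Q_n θ - P_n| + |Q_{n+1} θ - P_{n+1}|` in the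
direction given by the parity of `n` leads to another orbit point. -/
theorem exists_orbit_step {θ : ℝ} (hθ : Irrational θ) (n : ℕ) {k : ℕ}
    (hk : k < convDenom θ (n + 1)) :
    ∃ d : ℝ, 0 < d ∧ d ≤ convError θ n + convError θ (n + 1) ∧
      ∃ l : ℕ, l < convDenom θ (n + 1) ∧ ∃ m : ℤ, k * θ + (-1) ^ n * d = l * θ - m := by
  obtain ⟨⟨P, hP⟩, ⟨P', hP'⟩⟩ := exists_int_nums hθ n
  have e1 := convError_eq θ n
  have e2 := convError_eq θ (n + 1)
  have p1 := convError_pos hθ n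
  have p2 := convError_pos hθ (n + 1)
  have hle := convDenom_le_succ θ n
  rw [hP] at e1
  rw [hP', pow_succ] at e2
  -- Add `Q_n` to the index and, if it overflows, subtract `Q_{n+1}`. The errors of consecutive
  -- convergents have opposite signs, so both moves go in the same direction.
  by_cases h : k + convDenom θ n < convDenom θ (n + 1)
  · refine ⟨convError θ n, p1, by linarith, _, h, P, ?_⟩
    push_cast
    linear_combination -e1
  · refine ⟨_, by linarith, le_rfl, k + convDenom θ n - convDenom θ (n + 1), by omega,
      P - P', ?_⟩
    rw [Nat.cast_sub (by omega)]
    push_cast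
    linear_combination -e1 + e2

/-- In a longer segment, the orbit step from the left end (`n` even) or from the right end (`n` odd)
would land strictly inside. -/
theorem IsOrbitSegment.sub_le {θ : ℝ} (hθ : Irrational θ) (n : ℕ) {a b : ℝ}
    (h : IsOrbitSegment θ (convDenom θ (n + 1)) a b) :
    b - a ≤ convError θ n + convError θ (n + 1) := by
  obtain ⟨ha, hb, hab, hno⟩ := h
  have ha' := orbitPoints_subset_Icc _ _ ha
  have hb' := orbitPoints_subset_Icc _ _ hb
  obtain ⟨k, hk, m, hkm⟩ := exists_eq_of_mem_orbitPoints (convDenom_pos θ _) ha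
  obtain ⟨l, hl, m', hlm⟩ := exists_eq_of_mem_orbitPoints (convDenom_pos θ _) hb
  by_contra hcon
  push Not at hcon
  rcases neg_one_pow_eq_or ℝ n with hs | hs
  · obtain ⟨d, hd0, hd, j, hj, i, hji⟩ := exists_orbit_step hθ n hk
    rw [hs] at hji
    refine hno (a + d) (mem_orbitPoints_of_eq hj (m := i + m) ?_ ?_ ?_) ⟨?_, ?_⟩
    · push_cast
      linarith
    · linarith [ha'.1]
    · linarith [hb'.2]
    · linarith
    · linarith
  · obtain ⟨d, hd0, hd, j, hj, i, hji⟩ := exists_orbit_step hθ n hl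
    rw [hs] at hji
    refine hno (b - d) (mem_orbitPoints_of_eq hj (m := i + m') ?_ ?_ ?_) ⟨?_, ?_⟩
    · push_cast
      linarith
    · linarith [ha'.1]
    · linarith [hb'.2]
    · linarith
    · linarith

/-- Points of level `n + 1` are at least `d_n` apart, while gaps of level `n + 3` are at most
`d_{n+2} + d_{n+3} ≤ d_{n+1} < d_n`. One level would not suffice: if `a_{n+2} = 1`, the bound
`d_{n+1} + d_{n+2}` equals `d_n`. -/
theorem exists_mem_orbitPoints_between {θ : ℝ} (hθ : Irrational θ) (n : ℕ) {a b : ℝ}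
    (ha : a ∈ orbitPoints θ (convDenom θ (n + 1))) (hb : b ∈ orbitPoints θ (convDenom θ (n + 1)))
    (hab : a < b) : ∃ x ∈ orbitPoints θ (convDenom θ (n + 3)), a < x ∧ x < b := by
  by_contra hcon
  push Not at hcon
  have hsub := orbitPoints_mono θ (convDenom_mono θ (show n + 1 ≤ n + 3 by omega))
  have h1 : IsOrbitSegment θ (convDenom θ (n + 2 + 1)) a b :=
    ⟨hsub ha, hsub hb, hab, fun x hx hx' => absurd hx'.2 (not_lt.2 (hcon x hx hx'.1))⟩
  have h2 := h1.sub_le hθ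
  have h3 := convError_le_sub hθ n ha hb hab
  have h4 := convError_add_le hθ (n + 1)
  have h5 := convError_succ_lt hθ n
  linarith

/-! ### Staircase functions on increasing finite sets. -/

/-- The last point of `E` that is at most `x`. -/
noncomputable def prevPoint (E : Set ℝ) (x : ℝ) : ℝ := sSup {e | e ∈ E ∧ e ≤ x}

/-- The first point of `E` that is at least `x`. -/
noncomputable def nextPoint (E : Set ℝ) (x : ℝ) : ℝ := sInf {e | e ∈ E ∧ x ≤ e}

theorem isGreatest_prevPoint {E : Set ℝ} (hE : E.Finite) {x e : ℝ} (he : e ∈ E) (hx : e ≤ x) :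
    IsGreatest {e | e ∈ E ∧ e ≤ x} (prevPoint E x) := by
  have hf : {e | e ∈ E ∧ e ≤ x}.Finite := hE.subset fun _ h => h.1
  exact ⟨Set.Nonempty.csSup_mem ⟨e, he, hx⟩ hf, fun y hy => le_csSup hf.bddAbove hy⟩

theorem isLeast_nextPoint {E : Set ℝ} (hE : E.Finite) {x e : ℝ} (he : e ∈ E) (hx : x ≤ e) :
    IsLeast {e | e ∈ E ∧ x ≤ e} (nextPoint E x) := by
  have hf : {e | e ∈ E ∧ x ≤ e}.Finite := hE.subset fun _ h => h.1
  exact ⟨Set.Nonempty.csInf_mem ⟨e, he, hx⟩ hf, fun y hy => csInf_le hf.bddBelow hy⟩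

/-- The values at stage `n` of the staircase: a point that is new at stage `n + 1` gets a weighted
mean of the values at the neighbouring points of stage `n`. -/
noncomputable def stageValue (E : ℕ → Set ℝ) (w α : ℝ) : ℕ → ℝ → ℝ
  | 0, x => if x ≤ α then 0 else 1
  | n + 1, x => (1 - w) * stageValue E w α n (prevPoint (E n) x) +
      w * stageValue E w α n (nextPoint (E n) x)

theorem stageValue_succ_of_mem {E : ℕ → Set ℝ} (w α : ℝ) {n : ℕ} (hfin : (E n).Finite) {x : ℝ}
    (hx : x ∈ E n) : stageValue E w α (n + 1) x = stageValue E w α n x := by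
  have h1 := isGreatest_prevPoint hfin hx le_rfl
  have h2 := isLeast_nextPoint hfin hx le_rfl
  have e1 : prevPoint (E n) x = x := le_antisymm h1.1.2 (h1.2 ⟨hx, le_rfl⟩)
  have e2 : nextPoint (E n) x = x := le_antisymm (h2.2 ⟨hx, le_rfl⟩) h2.1.2
  rw [stageValue, e1, e2]
  ring

theorem monotoneOn_stageValue {E : ℕ → Set ℝ} {w α β : ℝ} (hαβ : α < β)
    (hfin : ∀ n, (E n).Finite) (hmono : Monotone E)
    (hE0 : E 0 = {α, β}) (hsub : ∀ n, E n ⊆ Icc α β) (hw0 : 0 ≤ w) (hw1 : w ≤ 1) (n : ℕ) :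
    MonotoneOn (stageValue E w α n) (E n) := by
  induction n with
  | zero =>
    intro x hx y hy hxy
    rw [hE0] at hx hy
    rcases hx with rfl | rfl <;> rcases hy with rfl | rfl <;> simp [stageValue] <;>
      split_ifs <;> simp
  | succ n ih =>
    have hα : α ∈ E n := hmono (Nat.zero_le n) (by rw [hE0]; simp)
    have hβ : β ∈ E n := hmono (Nat.zero_le n) (by rw [hE0]; simp)
    intro x hx y hy hxy
    have px := isGreatest_prevPoint (hfin n) hα (hsub _ hx).1
    have py := isGreatest_prevPoint (hfin n) hα (hsub _ hy).1
    have nx := isLeast_nextPoint (hfin n) hβ (hsub _ hx).2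
    have ny := isLeast_nextPoint (hfin n) hβ (hsub _ hy).2
    have h1 : prevPoint (E n) x ≤ prevPoint (E n) y := py.2 ⟨px.1.1, px.1.2.trans hxy⟩
    have h2 : nextPoint (E n) x ≤ nextPoint (E n) y := nx.2 ⟨ny.1.1, hxy.trans ny.1.2⟩
    have i1 := ih px.1.1 py.1.1 h1
    have i2 := ih nx.1.1 ny.1.1 h2
    simp only [stageValue]
    nlinarith

/-- Points that are neighbours at stage `n`. -/
def IsGap (E : Set ℝ) (a b : ℝ) : Prop := a ∈ E ∧ b ∈ E ∧ a < b ∧ ∀ x ∈ E, ¬ (a < x ∧ x < b)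

theorem stageValue_succ_of_isGap {E : ℕ → Set ℝ} (w α : ℝ) {n : ℕ} (hfin : (E n).Finite)
    {a b x : ℝ} (h : IsGap (E n) a b) (hx : x ∈ Ioo a b) :
    stageValue E w α (n + 1) x = (1 - w) * stageValue E w α n a + w * stageValue E w α n b := by
  obtain ⟨ha, hb, hab, hno⟩ := h
  have h1 := isGreatest_prevPoint hfin ha hx.1.le
  have h2 := isLeast_nextPoint hfin hb hx.2.le
  have e1 : prevPoint (E n) x = a := by
    refine le_antisymm ?_ (h1.2 ⟨ha, hx.1.le⟩)
    by_contra hcon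
    exact hno _ h1.1.1 ⟨not_le.1 hcon, h1.1.2.trans_lt hx.2⟩
  have e2 : nextPoint (E n) x = b := by
    refine le_antisymm (h2.2 ⟨hb, hx.2.le⟩) ?_
    by_contra hcon
    exact hno _ h2.1.1 ⟨hx.1.trans_le h2.1.2, not_le.1 hcon⟩
  rw [stageValue, e1, e2]

theorem exists_monotoneOn_of_isGap {E : ℕ → Set ℝ} {w α β : ℝ} (hαβ : α < β)
    (hfin : ∀ n, (E n).Finite) (hmono : Monotone E)
    (hE0 : E 0 = {α, β}) (hsub : ∀ n, E n ⊆ Icc α β) (hw0 : 0 ≤ w) (hw1 : w ≤ 1) :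
    ∃ F : ℝ → ℝ, MonotoneOn F (Icc α β) ∧ F α = 0 ∧ F β = 1 ∧
      ∀ n a b, IsGap (E n) a b → ∀ x ∈ E (n + 1), x ∈ Ioo a b →
        F x = (1 - w) * F a + w * F b := by
  set h := stageValue E w α with hh
  have hstab : ∀ n m, n ≤ m → ∀ x ∈ E n, h m x = h n x := by
    intro n m hnm x hx
    induction m, hnm using Nat.le_induction with
    | base => rfl
    | succ m hm ih => exact (stageValue_succ_of_mem w α (hfin m) (hmono hm hx)).trans ih
  have hα : ∀ n, α ∈ E n := fun n => hmono (Nat.zero_le n) (by rw [hE0]; simp)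
  have hβ : ∀ n, β ∈ E n := fun n => hmono (Nat.zero_le n) (by rw [hE0]; simp)
  -- The stage values agree wherever they are defined, so they form one monotone function on `⋃ E
  -- n`; it is extended by suprema from the left.
  set S : ℝ → Set ℝ := fun x => {v | ∃ n, ∃ e ∈ E n, e ≤ x ∧ v = h n e} with hS
  have hle : ∀ n m, ∀ x ∈ E n, ∀ y ∈ E m, x ≤ y → h n x ≤ h m y := by
    intro n m x hx y hy hxy
    rw [← hstab n (max n m) (le_max_left _ _) x hx, ← hstab m (max n m) (le_max_right _ _) y hy]
    exact monotoneOn_stageValue hαβ hfin hmono hE0 hsub hw0 hw1 _ (hmono (le_max_left _ _) hx)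
      (hmono (le_max_right _ _) hy) hxy
  have hF : ∀ n, ∀ x ∈ E n, sSup (S x) = h n x := by
    intro n x hx
    refine IsGreatest.csSup_eq ⟨⟨n, x, hx, le_rfl, rfl⟩, ?_⟩
    rintro v ⟨m, e, he, hex, rfl⟩
    exact hle m n e he x hx hex
  refine ⟨fun x => sSup (S x), ?_, ?_, ?_, ?_⟩
  · intro x hx y hy hxy
    refine csSup_le_csSup ⟨h 0 β, ?_⟩ ⟨h 0 α, 0, α, hα 0, hx.1, rfl⟩ ?_
    · rintro v ⟨m, e, he, hex, rfl⟩
      exact hle m 0 e he β (hβ 0) (hsub _ he).2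
    · rintro v ⟨m, e, he, hex, rfl⟩
      exact ⟨m, e, he, hex.trans hxy, rfl⟩
  · simp only [hF 0 α (hα 0), hh, stageValue]
    simp
  · simp only [hF 0 β (hβ 0), hh, stageValue]
    simp [hαβ]
  · intro n a b hab x hx hxab
    simp only [hF (n + 1) x hx, hF n a hab.1, hF n b hab.2.1]
    exact stageValue_succ_of_isGap w α (hfin n) hab hxab

/-- Both weights `w` and `1 - w` are at most 2/3, so a split leaves at most 2/3 of the increment on
either side, and every gap is split within two stages. -/
theorem MonotoneOn.sub_le_pow_of_isGap {E : ℕ → Set ℝ} {w α β : ℝ}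
    (hfin : ∀ n, (E n).Finite) (hmono : Monotone E)
    (hE0 : E 0 = {α, β}) (hsub : ∀ n, E n ⊆ Icc α β) (hw0 : 1 / 3 ≤ w) (hw1 : w ≤ 2 / 3)
    (hsplit : ∀ n, ∀ a ∈ E n, ∀ b ∈ E n, a < b → ∃ x ∈ E (n + 2), a < x ∧ x < b)
    {F : ℝ → ℝ} (hF : MonotoneOn F (Icc α β)) (hFα : F α = 0) (hFβ : F β = 1)
    (hgap : ∀ n a b, IsGap (E n) a b → ∀ x ∈ E (n + 1), x ∈ Ioo a b →
        F x = (1 - w) * F a + w * F b) (n : ℕ) {a b : ℝ} (hab : IsGap (E (2 * n)) a b) :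
    F b - F a ≤ (2 / 3) ^ n := by
  induction n generalizing a b with
  | zero =>
    obtain ⟨ha, hb, hlt, -⟩ := hab
    rw [mul_zero, hE0] at ha hb
    rcases ha with rfl | rfl <;> rcases hb with rfl | rfl <;> simp [hFα, hFβ]
  | succ n ih =>
    have hα : α ∈ E (2 * n) := hmono (Nat.zero_le _) (by rw [hE0]; simp)
    have hβ : β ∈ E (2 * n) := hmono (Nat.zero_le _) (by rw [hE0]; simp)
    obtain ⟨ha, hb, hlt, hno⟩ := hab
    have pA := isGreatest_prevPoint (hfin (2 * n)) hα (hsub _ ha).1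
    have pB := isLeast_nextPoint (hfin (2 * n)) hβ (hsub _ hb).2
    set A := prevPoint (E (2 * n)) a
    set B := nextPoint (E (2 * n)) b
    have hAa : A ≤ a := pA.1.2
    have hbB : b ≤ B := pB.1.2
    have hAB : IsGap (E (2 * n)) A B := by
      refine ⟨pA.1.1, pB.1.1, by linarith, fun x hx hx' => ?_⟩
      rcases le_or_gt x a with h | h
      · exact absurd (pA.2 ⟨hx, h⟩) (not_le.2 hx'.1)
      rcases le_or_gt b x with h' | h'
      · exact absurd (pB.2 ⟨hx, h'⟩) (not_le.2 hx'.2)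
      exact hno x (hmono (by omega) hx) ⟨h, h'⟩
    have hD := ih hAB
    have hAI := hsub _ hAB.1
    have hBI := hsub _ hAB.2.1
    have haI := hsub _ ha
    have hbI := hsub _ hb
    have hFD : F A ≤ F B := hF hAI hBI (by linarith)
    -- Either a point already appears at the intermediate stage, or `A` and `B` are still neighbours
    -- there and the mean rule applies one stage later.
    obtain ⟨x, hx, hxA, hxB, hFx⟩ : ∃ x ∈ E (2 * n + 2), A < x ∧ x < B ∧
        F x = (1 - w) * F A + w * F B := by
      by_cases hy : ∃ y ∈ E (2 * n + 1), A < y ∧ y < B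
      · obtain ⟨y, hy, h1, h2⟩ := hy
        exact ⟨y, hmono (by omega) hy, h1, h2, hgap _ _ _ hAB y hy ⟨h1, h2⟩⟩
      · push Not at hy
        obtain ⟨x, hx, h1, h2⟩ := hsplit _ A hAB.1 B hAB.2.1 hAB.2.2.1
        have hg : IsGap (E (2 * n + 1)) A B :=
          ⟨hmono (by omega) hAB.1, hmono (by omega) hAB.2.1, hAB.2.2.1,
            fun y hy1 hy2 => absurd hy2.2 (not_lt.2 (hy y hy1 hy2.1))⟩
        exact ⟨x, hx, h1, h2, hgap _ _ _ hg x hx ⟨h1, h2⟩⟩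
    have hxI := hsub _ hx
    have hmain : F b - F a ≤ 2 / 3 * (F B - F A) := by
      rcases le_or_gt x a with h | h
      · have h1 := hF hxI haI h
        have h2 := hF hbI hBI hbB
        nlinarith
      · have h' : b ≤ x := by
          by_contra hcon
          exact hno x hx ⟨h, not_le.1 hcon⟩
        have h1 := hF hbI hxI h'
        have h2 := hF hAI haI hAa
        nlinarith
    rw [pow_succ]
    linarith

theorem Set.Finite.exists_pos_le_sub {E : Set ℝ} (hE : E.Finite) :
    ∃ δ > 0, ∀ a ∈ E, ∀ b ∈ E, a < b → δ ≤ b - a := by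
  by_cases h : E.Nontrivial
  · refine ⟨E.infsep, hE.infsep_pos_iff_nontrivial.2 h, fun a ha b hb hab => ?_⟩
    have := Set.infsep_le_dist_of_mem hb ha hab.ne'
    rwa [Real.dist_eq, abs_of_pos (by linarith)] at this
  · refine ⟨1, one_pos, fun a ha b hb hab => ?_⟩
    exact absurd (Set.not_nontrivial_iff.1 h ha hb) hab.ne

/-- A monotone function with small increments over the gaps of suitable finite sets is
continuous. -/
theorem MonotoneOn.continuousOn_of_isGap {α β : ℝ} {F : ℝ → ℝ} (hF : MonotoneOn F (Icc α β))
    (h : ∀ ε > 0, ∃ E : Set ℝ, E.Finite ∧ α ∈ E ∧ β ∈ E ∧ E ⊆ Icc α β ∧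
      ∀ a b, IsGap E a b → F b - F a ≤ ε) : ContinuousOn F (Icc α β) := by
  refine UniformContinuousOn.continuousOn ?_
  rw [Metric.uniformContinuousOn_iff_le]
  intro ε hε
  obtain ⟨E, hfin, hα, hβ, hsub, hosc⟩ := h (ε / 2) (by linarith)
  obtain ⟨δ, hδ, hsep⟩ := hfin.exists_pos_le_sub
  -- Points closer than the separation `δ` of `E` lie in the same or in adjacent gaps, each
  -- contributing at most `ε / 2`.
  have key : ∀ x ∈ Icc α β, ∀ y ∈ Icc α β, x ≤ y → y - x ≤ δ / 2 → F y - F x ≤ ε := by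
    intro x hx y hy hxy hd
    have px := isGreatest_prevPoint hfin hα hx.1
    have nx := isLeast_nextPoint hfin hβ hx.2
    have py := isGreatest_prevPoint hfin hα hy.1
    have ny := isLeast_nextPoint hfin hβ hy.2
    have hx1 := px.1.2
    have hx2 := nx.1.2
    have hy1 := py.1.2
    have hy2 := ny.1.2
    have near : ∀ z, α ≤ z → z ≤ β →
        F (nextPoint E z) - F (prevPoint E z) ≤ ε / 2 := by
      intro z hz1 hz2
      have pz := isGreatest_prevPoint hfin hα hz1
      have nz := isLeast_nextPoint hfin hβ hz2
      rcases (pz.1.2.trans nz.1.2).eq_or_lt with he | he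
      · rw [he]
        linarith
      · refine hosc _ _ ⟨pz.1.1, nz.1.1, he, fun e he1 he2 => ?_⟩
        rcases le_total e z with h | h
        · exact absurd (pz.2 ⟨he1, h⟩) (not_le.2 he2.1)
        · exact absurd (nz.2 ⟨he1, h⟩) (not_le.2 he2.2)
    have nx' := near x hx.1 hx.2
    have ny' := near y hy.1 hy.2
    have m1 := hF (hsub px.1.1) hx hx1
    have m2 := hF hy (hsub ny.1.1) hy2
    have m3 : F (prevPoint E y) ≤ F (nextPoint E x) := by
      refine hF (hsub py.1.1) (hsub nx.1.1) ?_
      by_contra hcon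
      push Not at hcon
      have := hsep _ nx.1.1 _ py.1.1 hcon
      linarith
    linarith
  refine ⟨δ / 2, by linarith, fun x hx y hy hd => ?_⟩
  rw [Real.dist_eq] at hd ⊢
  rcases le_total x y with hxy | hxy
  · have := hF hx hy hxy
    rw [abs_sub_comm] at hd ⊢
    rw [abs_of_nonneg (by linarith)] at hd ⊢
    exact key x hx y hy hxy hd
  · have := hF hy hx hxy
    rw [abs_of_nonneg (by linarith)] at hd ⊢
    exact key y hy x hx hxy hd

theorem exists_continuousOn_staircase {E : ℕ → Set ℝ} {w α β : ℝ} (hαβ : α < β)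
    (hfin : ∀ n, (E n).Finite) (hmono : Monotone E)
    (hE0 : E 0 = {α, β}) (hsub : ∀ n, E n ⊆ Icc α β) (hw0 : 1 / 3 ≤ w) (hw1 : w ≤ 2 / 3)
    (hsplit : ∀ n, ∀ a ∈ E n, ∀ b ∈ E n, a < b → ∃ x ∈ E (n + 2), a < x ∧ x < b) :
    ∃ F : ℝ → ℝ, MonotoneOn F (Icc α β) ∧ ContinuousOn F (Icc α β) ∧ F α = 0 ∧ F β = 1 ∧
      ∀ n a b, IsGap (E n) a b → ∀ x ∈ E (n + 1), x ∈ Ioo a b →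
        F x = (1 - w) * F a + w * F b := by
  obtain ⟨F, hF, hα, hβ, hgap⟩ := exists_monotoneOn_of_isGap hαβ hfin hmono hE0 hsub
    (by linarith : 0 ≤ w) (by linarith)
  refine ⟨F, hF, hF.continuousOn_of_isGap fun ε hε => ?_, hα, hβ, hgap⟩
  obtain ⟨n, hn⟩ := exists_pow_lt_of_lt_one hε (show (2 / 3 : ℝ) < 1 by norm_num)
  refine ⟨E (2 * n), hfin _, hmono (Nat.zero_le _) (by rw [hE0]; simp),
    hmono (Nat.zero_le _) (by rw [hE0]; simp), hsub _, fun a b hab => ?_⟩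
  exact (hF.sub_le_pow_of_isGap hfin hmono hE0 hsub hw0 hw1 hsplit hα hβ hgap n hab).trans hn.le

/-! ### Construction of the singular function. -/

theorem mem_Ioo_of_partialQuotient_zero {θ : ℝ} (hθ : Irrational θ)
    (h0 : partialQuotient θ 0 = 0) : θ ∈ Ioo (0 : ℝ) 1 := by
  have h : ⌊θ⌋ = 0 := by
    have : ((⌊θ⌋ : ℤ) : ℝ) = 0 := by simpa [partialQuotient] using h0
    exact_mod_cast this
  have h1 := Int.floor_eq_zero_iff.1 h
  exact ⟨lt_of_le_of_ne h1.1 hθ.ne_zero.symm, h1.2⟩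

theorem convDenom_two {θ : ℝ} (hθ : Irrational θ) (h1 : partialQuotient θ 1 = 1)
    (h2 : partialQuotient θ 2 = 1) : convDenom θ 2 = 2 := by
  have h := convDenom_add_two hθ 0
  simp only [zero_add, convDenom_one hθ, h1, h2, convDenom_zero] at h
  norm_num at h
  exact_mod_cast h

theorem self_mem_orbitPoints {θ : ℝ} (hθ : θ ∈ Ioo (0 : ℝ) 1) {N : ℕ} (hN : 2 ≤ N) :
    θ ∈ orbitPoints θ N :=
  mem_orbitPoints_of_eq (k := 1) (by omega) (m := 0) (by simp) hθ.1.le hθ.2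

theorem orbitPoints_two {θ : ℝ} (hθ : θ ∈ Ioo (0 : ℝ) 1) : orbitPoints θ 2 = {0, θ, 1} := by
  ext x
  constructor
  · rintro (⟨k, hk, rfl⟩ | hx)
    · interval_cases k
      · simp
      · simp [Int.fract_eq_self.2 ⟨hθ.1.le, hθ.2⟩]
    · simp [mem_singleton_iff.1 hx]
  · rintro (rfl | rfl | rfl)
    · exact zero_mem_orbitPoints _ two_pos
    · exact self_mem_orbitPoints hθ le_rfl
    · exact one_mem_orbitPoints _ _

theorem fract_mem_orbitPoints (θ : ℝ) {k N : ℕ} (h : k < N) :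
    Int.fract ((k : ℝ) * θ) ∈ orbitPoints θ N := Or.inl ⟨k, h, rfl⟩

theorem exists_orbit_staircase {θ : ℝ} (hθ : Irrational θ) (hQ : convDenom θ 2 = 2)
    {α β w : ℝ} (hαβ : α < β)
    (hE0 : orbitPoints θ 2 ∩ Icc α β = {α, β})
    (hw0 : 1 / 3 ≤ w) (hw1 : w ≤ 2 / 3) :
    ∃ F : ℝ → ℝ, MonotoneOn F (Icc α β) ∧ ContinuousOn F (Icc α β) ∧ F α = 0 ∧ F β = 1 ∧
      ∀ ν : ℕ, 2 ≤ ν → ∀ a b : ℝ, IsOrbitSegment θ (convDenom θ ν) a b → α ≤ a → b ≤ β →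
        ∀ k : ℕ, k < convDenom θ (ν + 1) → Int.fract ((k : ℝ) * θ) ∈ Ioo a b →
          F (Int.fract ((k : ℝ) * θ)) = (1 - w) * F a + w * F b := by
  obtain ⟨F, hF, hFc, hα, hβ, hgap⟩ := exists_continuousOn_staircase
    -- The stages start at level 2, where `Q_2 = 2` and the orbit points are exactly 0, `θ`, 1.
    (E := fun n => orbitPoints θ (convDenom θ (n + 2)) ∩ Icc α β) hαβ
    (fun n => (finite_orbitPoints _ _).inter_of_left _)
    (fun m n hmn => inter_subset_inter_left _
      (orbitPoints_mono θ (convDenom_mono θ (by omega))))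
    (by simpa [hQ] using hE0) (fun n => inter_subset_right) hw0 hw1 (by
      rintro n a ⟨ha, ha'⟩ b ⟨hb, hb'⟩ hab
      obtain ⟨x, hx, h1, h2⟩ := exists_mem_orbitPoints_between hθ (n + 1) ha hb hab
      exact ⟨x, ⟨hx, by linarith [ha'.1], by linarith [hb'.2]⟩, h1, h2⟩)
  refine ⟨F, hF, hFc, hα, hβ, fun ν hν a b hab ha hb k hk hx => ?_⟩
  obtain ⟨n, rfl⟩ : ∃ n, ν = n + 2 := ⟨ν - 2, by omega⟩
  obtain ⟨ha', hb', hlt, hno⟩ := hab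
  refine hgap n a b ⟨⟨ha', ha, by linarith⟩, ⟨hb', by linarith, hb⟩, hlt,
    fun x hx => hno x hx.1⟩ _ ⟨?_, by linarith [hx.1], by linarith [hx.2]⟩ hx
  exact fract_mem_orbitPoints θ hk

theorem exists_isOrbitSingular {θ : ℝ} (hθ : Irrational θ) (hθI : θ ∈ Ioo (0 : ℝ) 1)
    (hQ : convDenom θ 2 = 2) :
    ∃ g : ℝ → ℝ, Continuous g ∧ Function.Periodic g 1 ∧ (∫ x in (0 : ℝ)..1, g x) = 0 ∧
      IsOrbitSingular θ g := by
  obtain ⟨h0, h1⟩ := hθI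
  obtain ⟨F, hF, hFc, hF0, hF1, hFg⟩ := exists_orbit_staircase hθ hQ (w := 2 / 3) h0 (by
      rw [orbitPoints_two ⟨h0, h1⟩]
      ext x
      simp only [mem_inter_iff, mem_insert_iff, mem_singleton_iff, mem_Icc]
      constructor
      · rintro ⟨rfl | rfl | rfl, h⟩
        · simp
        · simp
        · linarith
      · rintro (rfl | rfl)
        · simp [h0.le]
        · simp [h0.le]) (by norm_num) (by norm_num)
  obtain ⟨G, hG, hGc, hG0, hG1, hGg⟩ := exists_orbit_staircase hθ hQ (w := 1 / 2) h1 (by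
      rw [orbitPoints_two ⟨h0, h1⟩]
      ext x
      simp only [mem_inter_iff, mem_insert_iff, mem_singleton_iff, mem_Icc]
      constructor
      · rintro ⟨rfl | rfl | rfl, h⟩
        · linarith
        · simp
        · simp
      · rintro (rfl | rfl)
        · simp [h1.le]
        · simp [h1.le]) (by norm_num) (by norm_num)
  -- The pieces agree at `θ` (value 0) and at 0 and 1 (value 1). As the weights sum to 1, the mean
  -- rule survives the reflection `1 - F` and the later subtraction of a constant.
  set h : ℝ → ℝ := fun x => if x ≤ θ then 1 - F x else G x with hh
  have hl : EqOn h (fun x => 1 - F x) (Icc 0 θ) := fun x hx => if_pos hx.2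
  have hr : EqOn h G (Icc θ 1) := by
    intro x hx
    rcases hx.1.eq_or_lt with rfl | hlt
    · simp [hh, hF1, hG0]
    · exact if_neg (not_le.2 hlt)
  have hc : ContinuousOn h (Icc 0 1) := by
    rw [← Icc_union_Icc_eq_Icc h0.le h1.le]
    exact ((continuousOn_const.sub hFc).congr hl).union_of_isClosed (hGc.congr hr)
      isClosed_Icc isClosed_Icc
  have h01 : h 0 = h 1 := by
    rw [hl (left_mem_Icc.2 h0.le), hr (right_mem_Icc.2 h1.le)]
    simp [hF0, hG1]
  have hcont : Continuous (h ∘ Int.fract) := hc.comp_fract'' h01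
  set c := ∫ x in (0 : ℝ)..1, (h ∘ Int.fract) x with hcdef
  have hg : ∀ x ∈ Icc (0 : ℝ) 1, (h ∘ Int.fract) x - c = h x - c := by
    intro x hx
    rcases hx.2.eq_or_lt with rfl | hlt
    · simp [h01]
    · simp [Int.fract_eq_self.2 ⟨hx.1, hlt⟩]
  have hgl : ∀ x ∈ Icc (0 : ℝ) θ, (h ∘ Int.fract) x - c = 1 - F x - c := fun x hx => by
    rw [hg x ⟨hx.1, hx.2.trans h1.le⟩, hl hx]
  have hgr : ∀ x ∈ Icc θ (1 : ℝ), (h ∘ Int.fract) x - c = G x - c := fun x hx => by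
    rw [hg x ⟨h0.le.trans hx.1, hx.2⟩, hr hx]
  refine ⟨fun x => (h ∘ Int.fract) x - c, hcont.sub continuous_const, ?_, ?_, ?_⟩
  · intro x
    simp
  · rw [intervalIntegral.integral_sub (hcont.intervalIntegrable _ _)
      intervalIntegrable_const, ← hcdef]
    simp
  constructor
  · rw [hgl 0 (left_mem_Icc.2 h0.le), hgl θ (right_mem_Icc.2 h0.le), hF0, hF1]
    ring
  · intro x hx y hy hxy
    beta_reduce
    rw [hgl x hx, hgl y hy]
    linarith [hF hx hy hxy]
  · intro x hx y hy hxy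
    beta_reduce
    rw [hgr x hx, hgr y hy]
    linarith [hG hx hy hxy]
  · intro ν hν a b hab hb k _ hk hx
    have ha0 := (orbitPoints_subset_Icc _ _ hab.1).1
    rw [hgl _ ⟨by linarith [hx.1], by linarith [hx.2]⟩, hgl a ⟨ha0, by linarith [hab.2.2.1]⟩,
      hgl b ⟨by linarith [hab.2.2.1], hb⟩, hFg ν hν a b hab ha0 hb k hk hx]
    ring
  · intro ν hν a b hab ha k _ hk hx
    have hb1 := (orbitPoints_subset_Icc _ _ hab.2.1).2
    rw [hgr _ ⟨by linarith [hx.1], by linarith [hx.2]⟩, hgr a ⟨ha, by linarith [hab.2.2.1]⟩,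
      hgr b ⟨by linarith [hab.2.2.1], hb1⟩, hGg ν hν a b hab ha hb1 k hk hx]
    ring

/-! ### Total variation. -/

theorem eVariationOn_fun_neg (f : ℝ → ℝ) (s : Set ℝ) :
    eVariationOn (fun x => -f x) s = eVariationOn f s := by
  simp only [eVariationOn, edist_neg_neg]

theorem IsOrbitSingular.eVariationOn_eq {θ : ℝ} {g : ℝ → ℝ} (h : IsOrbitSingular θ g)
    (hθ : θ ∈ Ioo (0 : ℝ) 1) (h01 : g 1 = g 0) : eVariationOn g (Icc 0 1) = 2 := by
  have e1 : eVariationOn g (Icc 0 θ) = 1 := by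
    rw [← eVariationOn_fun_neg]
    have := h.antitoneOn.neg.eVariationOn_eq (left_mem_Icc.2 hθ.1.le) (right_mem_Icc.2 hθ.1.le)
    rw [inter_self] at this
    refine this.trans ?_
    have : -g θ - -g 0 = 1 := by linarith [h.drop]
    rw [this, ENNReal.ofReal_one]
  have e2 : eVariationOn g (Icc θ 1) = 1 := by
    have := h.monotoneOn.eVariationOn_eq (left_mem_Icc.2 hθ.2.le) (right_mem_Icc.2 hθ.2.le)
    rw [inter_self] at this
    rw [this, h01, h.drop, ENNReal.ofReal_one]
  have := eVariationOn.Icc_add_Icc g hθ.1.le hθ.2.le (mem_univ θ)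
  simp only [univ_inter] at this
  rw [← this, e1, e2]
  norm_num

/-! ### The orbit in increasing order. -/

theorem Finset.exists_nat_enumeration (s : Finset ℝ) {N : ℕ} (hcard : s.card = N + 1) :
    ∃ p : ℕ → ℝ, (∀ i ≤ N, p i ∈ s) ∧ (∀ i j, i < j → j ≤ N → p i < p j) ∧
      (∀ x ∈ s, ∃ i ≤ N, p i = x) ∧
      ∀ f : ℝ → ℝ, ∑ x ∈ s, f x = ∑ i ∈ Finset.range (N + 1), f (p i) := by
  set e := s.orderEmbOfFin hcard
  set p : ℕ → ℝ := fun i => if h : i < N + 1 then e ⟨i, h⟩ else 0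
  have hp : ∀ i (h : i < N + 1), p i = e ⟨i, h⟩ := fun i h => dif_pos h
  have hlt : ∀ i j, i < j → j ≤ N → p i < p j := fun i j hij hj => by
    rw [hp i (by omega), hp j (by omega)]
    exact e.strictMono hij
  have hmem : ∀ i ≤ N, p i ∈ s := fun i hi => by
    rw [hp i (by omega)]
    exact s.orderEmbOfFin_mem hcard _
  have hsurj : ∀ x ∈ s, ∃ i ≤ N, p i = x := fun x hx => by
    have : x ∈ Set.range e := by rw [s.range_orderEmbOfFin hcard]; exact hx
    obtain ⟨i, rfl⟩ := this
    exact ⟨i, by omega, hp i i.2⟩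
  refine ⟨p, hmem, hlt, hsurj, fun f => ?_⟩
  symm
  refine Finset.sum_bij (fun i _ => p i) (fun i hi => hmem i (by simp at hi; omega)) ?_ ?_
    (fun _ _ => rfl)
  · intro i hi j hj hij
    simp only [Finset.mem_range] at hi hj
    rcases lt_trichotomy i j with h | h | h
    · exact absurd hij (hlt i j h (by omega)).ne
    · exact h
    · exact absurd hij (hlt j i h (by omega)).ne'
  · intro x hx
    obtain ⟨i, hi, h⟩ := hsurj x hx
    exact ⟨i, by simp; omega, h⟩

theorem fract_nat_mul_injective {θ : ℝ} (hθ : Irrational θ) :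
    Function.Injective fun k : ℕ => Int.fract ((k : ℝ) * θ) := by
  intro k l hkl
  obtain ⟨z, hz⟩ := Int.fract_eq_fract.1 hkl
  by_contra hne
  have h : ((k : ℤ) - l : ℤ) ≠ 0 := by omega
  refine (hθ.intCast_mul h).ne_int z ?_
  push_cast
  linarith

/-- Enumeration of the orbit points in increasing order. -/
theorem exists_orbit_enumeration {θ : ℝ} (hθ : Irrational θ) {N : ℕ} (hN : 0 < N) :
    ∃ p : ℕ → ℝ, p 0 = 0 ∧ p N = 1 ∧ (∀ i < N, IsOrbitSegment θ N (p i) (p (i + 1))) ∧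
      (∀ x ∈ orbitPoints θ N, ∃ i ≤ N, p i = x) ∧ (∀ i j, i < j → j ≤ N → p i < p j) ∧
      ∀ f : ℝ → ℝ, ∑ k ∈ Finset.range N, f (Int.fract ((k : ℝ) * θ)) =
        ∑ i ∈ Finset.range N, f (p i) := by
  classical
  set t : Finset ℝ := (Finset.range N).image (fun k : ℕ => Int.fract ((k : ℝ) * θ)) with ht
  have h1 : (1 : ℝ) ∉ t := by
    simp only [ht, Finset.mem_image, not_exists, not_and]
    intro k _ h
    linarith [Int.fract_lt_one ((k : ℝ) * θ)]
  have hs : ∀ x, x ∈ insert 1 t ↔ x ∈ orbitPoints θ N := by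
    intro x
    simp only [ht, Finset.mem_insert, Finset.mem_image, Finset.mem_range, orbitPoints,
      mem_union, mem_ofPred_eq, mem_singleton_iff]
    constructor
    · rintro (h | ⟨k, hk, h⟩)
      · exact Or.inr h
      · exact Or.inl ⟨k, hk, h.symm⟩
    · rintro (⟨k, hk, h⟩ | h)
      · exact Or.inr ⟨k, hk, h.symm⟩
      · exact Or.inl h
  have hcard : (insert 1 t).card = N + 1 := by
    rw [Finset.card_insert_of_notMem h1, ht,
      Finset.card_image_of_injective _ (fract_nat_mul_injective hθ), Finset.card_range]
  obtain ⟨p, hmem, hlt, hsurj, hsum⟩ := (insert 1 t).exists_nat_enumeration hcard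
  simp only [hs] at hmem hsurj
  have hle : ∀ i j, i ≤ j → j ≤ N → p i ≤ p j := fun i j hij hj => by
    rcases hij.eq_or_lt with rfl | h
    · exact le_rfl
    · exact (hlt i j h hj).le
  have hpN : p N = 1 := by
    obtain ⟨i, hi, h⟩ := hsurj 1 (one_mem_orbitPoints _ _)
    have := hle i N hi le_rfl
    exact le_antisymm (orbitPoints_subset_Icc _ _ (hmem N le_rfl)).2 (h ▸ this)
  refine ⟨p, ?_, hpN, ?_, hsurj, hlt, fun f => ?_⟩
  · obtain ⟨i, hi, h⟩ := hsurj 0 (zero_mem_orbitPoints _ hN)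
    have := hle 0 i (Nat.zero_le _) hi
    exact le_antisymm (h ▸ this) (orbitPoints_subset_Icc _ _ (hmem 0 (Nat.zero_le _))).1
  · intro i hi
    refine ⟨hmem i hi.le, hmem (i + 1) hi, hlt i (i + 1) (by omega) hi, ?_⟩
    rintro x hx ⟨hx1, hx2⟩
    obtain ⟨j, hj, rfl⟩ := hsurj x hx
    have h1 : i < j := by
      by_contra hcon
      exact absurd (hle j i (by omega) hi.le) (not_le.2 hx1)
    exact absurd (hle (i + 1) j h1 hj) (not_le.2 hx2)
  -- The endpoint 1 contributes `f 1` to both sides and cancels.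
  · have h2 := hsum f
    rw [Finset.sum_insert h1, Finset.sum_range_succ, hpN, ht,
      Finset.sum_image fun _ _ _ _ h => fract_nat_mul_injective hθ h] at h2
    linarith

/-! ### Plateaus and the estimate of the orbit sums. -/

theorem abs_integral_sub_le_of_plateau {g : ℝ → ℝ} (hg : Continuous g) {a b η W D : ℝ}
    (hab : a ≤ b) (hη : 0 ≤ η) (hD : ∀ x ∈ Icc a b, |g x - W| ≤ D)
    (hW : ∀ x ∈ Ioo (a + η) (b - η), g x = W) :
    |(∫ x in a..b, g x) - (b - a) * W| ≤ 2 * η * D := by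
  have hD0 : 0 ≤ D := (abs_nonneg _).trans (hD a (left_mem_Icc.2 hab))
  have hgi : ∀ u v, IntervalIntegrable (fun x => g x - W) MeasureTheory.volume u v :=
    fun u v => (hg.sub continuous_const).intervalIntegrable u v
  have bound : ∀ u v, a ≤ u → u ≤ v → v ≤ b → |∫ x in u..v, g x - W| ≤ D * (v - u) := by
    intro u v hu huv hv
    have := intervalIntegral.norm_integral_le_of_norm_le_const (f := fun x => g x - W) (a := u)
      (b := v) (C := D) (fun x hx => by
        rw [uIoc_of_le huv] at hx
        exact hD x ⟨by linarith [hx.1], by linarith [hx.2]⟩)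
    rwa [abs_of_nonneg (by linarith : 0 ≤ v - u)] at this
  have e : (∫ x in a..b, g x) - (b - a) * W = ∫ x in a..b, g x - W := by
    rw [intervalIntegral.integral_sub (hg.intervalIntegrable _ _) intervalIntegrable_const]
    simp
  rw [e]
  rcases le_or_gt (b - a) (2 * η) with h | h
  · have := bound a b le_rfl hab le_rfl
    nlinarith
  · have h1 := bound a (a + η) le_rfl (by linarith) (by linarith)
    have h2 := bound (b - η) b (by linarith) (by linarith) le_rfl
    have h3 : ∫ x in (a + η)..(b - η), g x - W = 0 := by
      refine intervalIntegral.integral_zero_ae ?_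
      filter_upwards [MeasureTheory.Measure.ae_ne MeasureTheory.volume (b - η)] with x hx hx'
      rw [uIoc_of_le (by linarith)] at hx'
      rw [hW x ⟨hx'.1, lt_of_le_of_ne hx'.2 hx⟩, sub_self]
    rw [← intervalIntegral.integral_add_adjacent_intervals (hgi a (a + η)) (hgi _ b),
      ← intervalIntegral.integral_add_adjacent_intervals (hgi (a + η) (b - η)) (hgi _ b), h3]
    rw [abs_le] at *
    constructor <;> linarith

/-- A monotone function which takes a single value at the orbit points newly appearing inside a
segment takes this value on the whole segment, up to its ends. -/
theorem IsOrbitSegment.eq_of_mem_plateau {θ : ℝ} (hθ : Irrational θ) {n : ℕ} {a b W : ℝ}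
    (h : IsOrbitSegment θ (convDenom θ (n + 1)) a b) {g : ℝ → ℝ}
    (hmon : MonotoneOn g (Icc a b) ∨ AntitoneOn g (Icc a b))
    (hval : ∀ k : ℕ, convDenom θ (n + 1) ≤ k → k < convDenom θ (n + 2) →
      Int.fract ((k : ℝ) * θ) ∈ Ioo a b → g (Int.fract ((k : ℝ) * θ)) = W) :
    ∀ x ∈ Ioo (a + (convError θ (n + 1) + convError θ (n + 2)))
      (b - (convError θ (n + 1) + convError θ (n + 2))), g x = W := by
  obtain ⟨ha, hb, hab, hno⟩ := h
  have ha' := orbitPoints_subset_Icc _ _ ha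
  have hb' := orbitPoints_subset_Icc _ _ hb
  have p1 := convError_pos hθ (n + 1)
  have p2 := convError_pos hθ (n + 2)
  -- A segment contains no old orbit point, so a point inside it has index at least `Q_{n+1}`.
  have hnew : ∀ u ∈ orbitPoints θ (convDenom θ (n + 2)), u ∈ Ioo a b → g u = W := by
    rintro u (⟨k, hk, rfl⟩ | hu) hu'
    · refine hval k ?_ hk hu'
      by_contra hcon
      exact hno _ (fract_mem_orbitPoints θ (not_le.1 hcon)) hu'
    · rw [mem_singleton_iff.1 hu] at hu'
      linarith [hu'.2, hb'.2]
  intro x hx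
  have hsub := orbitPoints_mono θ (convDenom_le_succ θ (n + 1))
  have pu := isGreatest_prevPoint (finite_orbitPoints θ (convDenom θ (n + 2))) (x := x) (hsub ha)
    (by linarith [hx.1])
  have pv := isLeast_nextPoint (finite_orbitPoints θ (convDenom θ (n + 2))) (x := x) (hsub hb)
    (by linarith [hx.2])
  obtain ⟨⟨hu, hux⟩, hu2⟩ := pu
  obtain ⟨⟨hv, hxv⟩, hv2⟩ := pv
  set u := prevPoint (orbitPoints θ (convDenom θ (n + 2))) x
  set v := nextPoint (orbitPoints θ (convDenom θ (n + 2))) x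
  have huv : v - u ≤ convError θ (n + 1) + convError θ (n + 2) := by
    rcases (hux.trans hxv).eq_or_lt with he | hlt
    · linarith
    · refine IsOrbitSegment.sub_le hθ (n + 1) ⟨hu, hv, hlt, fun y hy hy' => ?_⟩
      rcases le_total y x with h | h
      · exact absurd (hu2 ⟨hy, h⟩) (not_le.2 hy'.1)
      · exact absurd (hv2 ⟨hy, h⟩) (not_le.2 hy'.2)
  -- The next-level neighbours of `x` are within the margin, hence new points with value `W`;
  -- monotonicity squeezes `g x` between them.
  have hua : a < u := by linarith [hx.1]
  have hvb : v < b := by linarith [hx.2]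
  have gu := hnew u hu ⟨hua, by linarith⟩
  have gv := hnew v hv ⟨by linarith, hvb⟩
  have mu : u ∈ Icc a b := ⟨hua.le, by linarith⟩
  have mv : v ∈ Icc a b := ⟨by linarith, hvb.le⟩
  have mx : x ∈ Icc a b := ⟨by linarith, by linarith⟩
  rcases hmon with hm | hm
  · linarith [hm mu mx hux, hm mx mv hxv]
  · linarith [hm mu mx hux, hm mx mv hxv]

theorem sum_ite_mul_sub (G : ℕ → ℝ) (A B : ℝ) {m N : ℕ} (hmN : m ≤ N) :
    ∑ i ∈ Finset.range N, (if i < m then A else B) * (G (i + 1) - G i) =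
      A * (G m - G 0) + B * (G N - G m) := by
  induction N, hmN using Nat.le_induction with
  | base =>
    rw [Finset.sum_congr rfl (g := fun i => A * (G (i + 1) - G i)), ← Finset.mul_sum,
      Finset.sum_range_sub]
    · simp
    · intro i hi
      rw [if_pos (Finset.mem_range.1 hi)]
  | succ N hmN ih =>
    rw [Finset.sum_range_succ, ih, if_neg (by omega)]
    ring

/-- The values lie in `[g θ, g θ + 1]`, and this interval contains the mean value 0. -/
theorem IsOrbitSingular.abs_le_one {θ : ℝ} {g : ℝ → ℝ} (h : IsOrbitSingular θ g)
    (hθ : θ ∈ Ioo (0 : ℝ) 1) (hg : Continuous g) (h01 : g 1 = g 0)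
    (hint : (∫ x in (0 : ℝ)..1, g x) = 0) {x : ℝ} (hx : x ∈ Icc (0 : ℝ) 1) : |g x| ≤ 1 := by
  have hd := h.drop
  have key : ∀ x ∈ Icc (0 : ℝ) 1, g θ ≤ g x ∧ g x ≤ g θ + 1 := by
    intro x hx
    rcases le_total x θ with hxθ | hxθ
    · have h1 := h.antitoneOn ⟨hx.1, hxθ⟩ (right_mem_Icc.2 hθ.1.le) hxθ
      have h2 := h.antitoneOn (left_mem_Icc.2 hθ.1.le) ⟨hx.1, hxθ⟩ hx.1
      exact ⟨h1, by linarith⟩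
    · have h1 := h.monotoneOn (left_mem_Icc.2 hθ.2.le) ⟨hxθ, hx.2⟩ hxθ
      have h2 := h.monotoneOn ⟨hxθ, hx.2⟩ (right_mem_Icc.2 hθ.2.le) hx.2
      exact ⟨h1, by linarith⟩
  have h1 := intervalIntegral.integral_mono_on (μ := MeasureTheory.volume) zero_le_one
    (f := fun _ => g θ) intervalIntegrable_const (hg.intervalIntegrable _ _)
    (fun x hx => (key x hx).1)
  have h2 := intervalIntegral.integral_mono_on (μ := MeasureTheory.volume) zero_le_one
    (g := fun _ => g θ + 1) (hg.intervalIntegrable _ _) intervalIntegrable_const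
    (fun x hx => (key x hx).2)
  rw [hint] at h1 h2
  simp at h1 h2
  have := key x hx
  rw [abs_le]
  constructor <;> linarith

/-- The quantitative core. The condition `1 ≤ n` puts the level `n + 1` at 2 or above, where the
mean rule is in force and `θ` is an orbit point. -/
theorem IsOrbitSingular.abs_sum_sub_le {θ : ℝ} (hθ : Irrational θ) {g : ℝ → ℝ}
    (h : IsOrbitSingular θ g) (hθI : θ ∈ Ioo (0 : ℝ) 1) (hg : Continuous g)
    (hper : Function.Periodic g 1) (hint : (∫ x in (0 : ℝ)..1, g x) = 0)
    (hQ : convDenom θ 2 = 2) {n : ℕ} (hn : 1 ≤ n) :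
    |∑ k ∈ Finset.range (convDenom θ (n + 1)), g ((k : ℝ) * θ) - 1 / 6| ≤
      10 * (convDenom θ n / partialQuotient θ (n + 2)) := by
  have h01 : g 1 = g 0 := by simpa using hper 0
  have hQ2 : 2 ≤ convDenom θ (n + 1) := hQ ▸ convDenom_mono θ (by omega)
  obtain ⟨p, hp0, hpN, hseg, hsurj, hlt, hsum⟩ :=
    exists_orbit_enumeration hθ (convDenom_pos θ (n + 1))
  obtain ⟨m, hmN, hm⟩ := hsurj θ (self_mem_orbitPoints hθI hQ2)
  set N := convDenom θ (n + 1) with hN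
  set η := convError θ (n + 1) + convError θ (n + 2) with hη
  have hη0 : 0 < η := add_pos (convError_pos hθ _) (convError_pos hθ _)
  have hle : ∀ i j, i ≤ j → j ≤ N → p i ≤ p j := fun i j hij hj => by
    rcases hij.eq_or_lt with rfl | h
    · exact le_rfl
    · exact (hlt i j h hj).le
  have hpI : ∀ i ≤ N, p i ∈ Icc (0 : ℝ) 1 := fun i hi =>
    ⟨hp0 ▸ hle 0 i (Nat.zero_le _) hi, hpN ▸ hle i N hi le_rfl⟩
  set c : ℕ → ℝ := fun i => if i < m then 2 / 3 else 1 / 2 with hc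
  set W : ℕ → ℝ := fun i => g (p i) + c i * (g (p (i + 1)) - g (p i)) with hW
  have hsumW : ∑ i ∈ Finset.range N, W i =
      ∑ k ∈ Finset.range N, g ((k : ℝ) * θ) - 1 / 6 := by
    have e1 : ∀ k ∈ Finset.range N, g ((k : ℝ) * θ) = g (Int.fract ((k : ℝ) * θ)) := by
      intro k _
      rw [Int.fract]
      simpa using (hper.sub_zsmul_eq ⌊(k : ℝ) * θ⌋ (x := (k : ℝ) * θ)).symm
    rw [Finset.sum_congr rfl e1, hsum g, hW, Finset.sum_add_distrib,
      sum_ite_mul_sub (fun i => g (p i)) _ _ hmN, hp0, hpN, hm, h01]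
    linarith [h.drop]
  have hsegment : ∀ i < N, |(∫ x in (p i)..(p (i + 1)), g x) - (p (i + 1) - p i) * W i| ≤
      2 * η * ((if i < m then -1 else 1) * (g (p (i + 1)) - g (p i))) := by
    intro i hi
    have hs := hseg i hi
    have hI := hpI i hi.le
    have hI' := hpI (i + 1) hi
    have hlei := hs.2.2.1.le
    by_cases him : i < m
    · have hbθ : p (i + 1) ≤ θ := hm ▸ hle (i + 1) m him hmN
      have hanti : AntitoneOn g (Icc (p i) (p (i + 1))) :=
        h.antitoneOn.mono (Icc_subset_Icc hI.1 hbθ)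
      refine abs_integral_sub_le_of_plateau hg hlei hη0.le (fun x hx => ?_) ?_
      · have h1 := hanti (left_mem_Icc.2 hlei) hx hx.1
        have h2 := hanti hx (right_mem_Icc.2 hlei) hx.2
        simp only [hW, hc, him, if_true]
        rw [abs_le]
        constructor <;> linarith
      · refine hs.eq_of_mem_plateau hθ (Or.inr hanti) fun k hk1 hk2 hk => ?_
        rw [h.left (n + 1) (by omega) _ _ hs hbθ k hk1 hk2 hk]
        simp only [hW, hc, him, if_true]
        ring
    · have haθ : θ ≤ p i := hm ▸ hle m i (by omega) hi.le
      have hmono : MonotoneOn g (Icc (p i) (p (i + 1))) :=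
        h.monotoneOn.mono (Icc_subset_Icc haθ hI'.2)
      refine abs_integral_sub_le_of_plateau hg hlei hη0.le (fun x hx => ?_) ?_
      · have h1 := hmono (left_mem_Icc.2 hlei) hx hx.1
        have h2 := hmono hx (right_mem_Icc.2 hlei) hx.2
        simp only [hW, hc, him, if_false]
        rw [abs_le]
        constructor <;> linarith
      · refine hs.eq_of_mem_plateau hθ (Or.inl hmono) fun k hk1 hk2 hk => ?_
        rw [h.right (n + 1) (by omega) _ _ hs haθ k hk1 hk2 hk]
        simp only [hW, hc, him, if_false]
        ring
  have hWle : ∀ i < N, |W i| ≤ 1 := by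
    intro i hi
    have h1 := abs_le.1 (h.abs_le_one hθI hg h01 hint (hpI i hi.le))
    have h2 := abs_le.1 (h.abs_le_one hθI hg h01 hint (hpI (i + 1) hi))
    rw [abs_le]
    simp only [hW, hc]
    split_ifs <;> constructor <;> linarith
  have hN0 : (0 : ℝ) < N := by
    have : 0 < N := by omega
    exact_mod_cast this
  have hintsum : ∑ i ∈ Finset.range N, ∫ x in (p i)..(p (i + 1)), g x = 0 := by
    rw [intervalIntegral.sum_integral_adjacent_intervals
      (fun k _ => hg.intervalIntegrable _ _), hp0, hpN, hint]
  have hdet := convError_det hθ n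
  have hd0 := convError_pos hθ n
  have hd1 := convError_pos hθ (n + 1)
  have hd2 := convError_pos hθ (n + 2)
  set d := convError θ n with hd
  have hdN : d * N ≤ 1 := convError_mul_le_one hθ n
  -- Compare both 1 and `N` times the length with `N * d`, a lower bound for each. Both differences
  -- are nonnegative, so they can be summed without absolute values.
  have hlen : ∀ i < N, |W i * (1 - N * (p (i + 1) - p i))| ≤
      (N * (p (i + 1) - p i) - N * d) + (1 - N * d) := by
    intro i hi
    have hs := hseg i hi
    have h1 : d ≤ p (i + 1) - p i := convError_le_sub hθ n hs.1 hs.2.1 hs.2.2.1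
    have h2 : N * d ≤ N * (p (i + 1) - p i) := mul_le_mul_of_nonneg_left h1 hN0.le
    rw [abs_mul]
    refine (mul_le_of_le_one_left (abs_nonneg _) (hWle i hi)).trans ?_
    rw [abs_le]
    constructor <;> linarith
  have hlensum : ∑ i ∈ Finset.range N, ((N * (p (i + 1) - p i) - N * d) + (1 - N * d)) =
      2 * N * (convError θ (n + 1) * convDenom θ n) := by
    rw [Finset.sum_add_distrib, Finset.sum_sub_distrib, ← Finset.mul_sum, Finset.sum_range_sub,
      hp0, hpN]
    simp only [Finset.sum_const, Finset.card_range, nsmul_eq_mul]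
    linear_combination (-2 * (N : ℝ)) * hdet
  -- The signed increments add up to the total variation 2.
  have hvar : ∑ i ∈ Finset.range N,
      2 * η * ((if i < m then -1 else 1) * (g (p (i + 1)) - g (p i))) = 4 * η := by
    rw [← Finset.mul_sum, sum_ite_mul_sub (fun i => g (p i)) _ _ hmN, hp0, hpN, hm, h01]
    linear_combination (4 * η) * h.drop
  -- Replace 1 by `N` times the segment length; the resulting length-weighted sum is minus the
  -- plateau error, because the integrals add up to 0.
  have hsplit : ∑ i ∈ Finset.range N, W i =
      ∑ i ∈ Finset.range N, W i * (1 - N * (p (i + 1) - p i)) -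
        N * ∑ i ∈ Finset.range N,
          ((∫ x in (p i)..(p (i + 1)), g x) - (p (i + 1) - p i) * W i) := by
    rw [Finset.sum_sub_distrib, hintsum, zero_sub, mul_neg, sub_neg_eq_add, Finset.mul_sum,
      ← Finset.sum_add_distrib]
    exact Finset.sum_congr rfl fun i _ => by ring
  have b1 : |∑ i ∈ Finset.range N, W i * (1 - N * (p (i + 1) - p i))| ≤
      2 * N * (convError θ (n + 1) * convDenom θ n) := by
    rw [← hlensum]
    exact (Finset.abs_sum_le_sum_abs _ _).trans
      (Finset.sum_le_sum fun i hi => hlen i (Finset.mem_range.1 hi))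
  have b2 : |∑ i ∈ Finset.range N,
      ((∫ x in (p i)..(p (i + 1)), g x) - (p (i + 1) - p i) * W i)| ≤ 4 * η := by
    rw [← hvar]
    exact (Finset.abs_sum_le_sum_abs _ _).trans
      (Finset.sum_le_sum fun i hi => hsegment i (Finset.mem_range.1 hi))
  -- From `d_{n+1} Q_{n+2} ≤ 1` and `Q_{n+2} ≥ a_{n+2} Q_{n+1}`.
  have b3 : (N : ℝ) * convError θ (n + 1) ≤ 1 / partialQuotient θ (n + 2) := by
    have ha := one_le_partialQuotient hθ (n + 1)
    have h1 := convError_mul_le_one hθ (n + 1)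
    rw [convDenom_add_two hθ n] at h1
    rw [le_div_iff₀ (by linarith)]
    have h2 : 0 ≤ convError θ (n + 1) * convDenom θ n := mul_nonneg hd1.le (Nat.cast_nonneg _)
    linarith
  have hη2 : η ≤ 2 * convError θ (n + 1) := by linarith [convError_succ_lt hθ (n + 1)]
  have hQ1 : (1 : ℝ) ≤ convDenom θ n := by exact_mod_cast convDenom_pos θ n
  rw [← hsumW, hsplit]
  -- The constant 10 is 2 from the unequal lengths plus 8 from the plateau ends, the latter after `η
  -- ≤ 2 d_{n+1}` and `1 ≤ Q_n`.
  calc _ ≤ 2 * N * (convError θ (n + 1) * convDenom θ n) + N * (4 * η) := by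
        refine (abs_sub _ _).trans (add_le_add b1 ?_)
        rw [abs_mul, abs_of_pos hN0]
        exact mul_le_mul_of_nonneg_left b2 hN0.le
    _ ≤ 2 * (N * convError θ (n + 1)) * convDenom θ n + 8 * (N * convError θ (n + 1)) * 1 := by
        nlinarith
    _ ≤ 2 * (N * convError θ (n + 1)) * convDenom θ n +
        8 * (N * convError θ (n + 1)) * convDenom θ n := by
        gcongr
    _ = 10 * convDenom θ n * (N * convError θ (n + 1)) := by ring
    _ ≤ 10 * convDenom θ n * (1 / partialQuotient θ (n + 2)) := by gcongr
    _ = _ := by ring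

theorem theorem2 (θ : ℝ) (hθ : Irrational θ)
    (h0 : partialQuotient θ 0 = 0) (h1 : partialQuotient θ 1 = 1) (h2 : partialQuotient θ 2 = 1)
    (hlim : Tendsto (fun ν : ℕ => (convDenom θ ν : ℝ) / partialQuotient θ (ν + 2)) atTop (𝓝 0)) :
    ∃ g : ℝ → ℝ,
      Continuous g ∧
      Function.Periodic g 1 ∧
      BoundedVariationOn g (Icc 0 1) ∧
      eVariationOn g (Icc 0 1) = 2 ∧
      (∫ x in (0 : ℝ)..1, g x) = 0 ∧
      IsOrbitSingular θ g ∧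
      Tendsto (fun ν : ℕ => ∑ k ∈ Finset.range (convDenom θ ν), g ((k : ℝ) * θ)) atTop
        (𝓝 (1 / 6)) ∧
      0 < liminf (fun ν : ℕ => ∑ k ∈ Finset.range (convDenom θ ν), g ((k : ℝ) * θ)) atTop := by
  have hθI := mem_Ioo_of_partialQuotient_zero hθ h0
  have hQ := convDenom_two hθ h1 h2
  obtain ⟨g, hg, hper, hint, hsing⟩ := exists_isOrbitSingular hθ hθI hQ
  have hvar := hsing.eVariationOn_eq hθI (by simpa using hper 0)
  have hT : Tendsto (fun ν : ℕ => ∑ k ∈ Finset.range (convDenom θ ν), g ((k : ℝ) * θ)) atTop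
      (𝓝 (1 / 6)) := by
    rw [← tendsto_add_atTop_iff_nat 1, tendsto_iff_norm_sub_tendsto_zero]
    refine squeeze_zero' (Eventually.of_forall fun _ => norm_nonneg _) ?_
      (by simpa using hlim.const_mul 10)
    filter_upwards [eventually_ge_atTop 1] with n hn
    exact hsing.abs_sum_sub_le hθ hθI hg hper hint hQ hn
  refine ⟨g, hg, hper, ?_, hvar, hint, hsing, hT, ?_⟩
  · rw [BoundedVariationOn, hvar]
    exact ENNReal.ofNat_ne_top
  · rw [hT.liminf_eq]
    norm_num
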